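/- For $n\in\mathbb N=\{0,1,2,\dots\}$ let $S_n$ be the symmetric group on $\{1,\dots,n\}$, let $T_n$ be the full transformation monoid of all functions from $\{1,\dots,n\}$ to itself under composition, and let $I_n$ be the symmetric inverse monoid of all bijections between subsets of $\{1,\dots,n\}$ under composition of binary relations. A monoid $M$ is monogenic if $M=\{m^k : k\in\mathbb N\}$ for some $m\in M$. An inverse monoid $M$ is a monogenic inverse monoid if there is $m\in M$ such that $M$ is generated as a monoid by $m$ and $m^{-1}$. Let $s(n)$ be the number of cyclic subgroups of $S_n$ up to isomorphism (equivalently, the number of distinct orders of elements of $S_n$; in particular $s(0)=s(1)=1$), let $t(n)$ be the number of monogenic submonoids of $T_n$ up to isomorphism, and let $i(n)$ be the number of monogenic inverse submonoids of $I_n$ up to isomorphism. Then for every $n\in\mathbb N$ with $n>1$, $$t(n)=\sum_{k=1}^{n}s(k)\qquad\text{and}\qquad i(n)=\sum_{k=0}^{n}s(k)=t(n)+1 .$$ -/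

import Mathlib

/-- Two members of a family of types with multiplication are identified when they are isomorphic.
For monoids, a multiplicative bijection automatically preserves `1` (and, in inverse monoids and
groups, inverses). -/
def isoSetoid {ι : Type} (F : ι → Type) [∀ i, Mul (F i)] : Setoid ι where
  r i j := Nonempty (F i ≃* F j)
  iseqv :=
    ⟨fun i => ⟨MulEquiv.refl (F i)⟩, fun ⟨e⟩ => ⟨e.symm⟩, fun ⟨e⟩ ⟨f⟩ => ⟨e.trans f⟩⟩

/-- The number of isomorphism classes of members of a family of types with multiplication. -/
noncomputable def numIsoClasses {ι : Type} (F : ι → Type) [∀ i, Mul (F i)] : ℕ :=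
  Nat.card (Quotient (isoSetoid F))

/-- A monoid is monogenic if it consists of the powers `m ^ k`, `k ≥ 0`, of one element `m`. -/
def IsMonogenicMonoid (M : Type) [Monoid M] : Prop :=
  ∃ m : M, ∀ x : M, ∃ k : ℕ, x = m ^ k

/-- An inverse monoid: every `x` has exactly one inverse `x⁻¹` in the sense of semigroups. -/
class InverseMonoid (M : Type) extends Monoid M, Inv M where
  mul_inv_mul_cancel : ∀ x : M, x * x⁻¹ * x = x
  inv_mul_inv_cancel : ∀ x : M, x⁻¹ * x * x⁻¹ = x⁻¹
  eq_inv_of_mul : ∀ x y : M, x * y * x = x → y * x * y = y → y = x⁻¹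

/-- An inverse submonoid of an inverse monoid: a submonoid closed under inverses. -/
def IsInverseSubmonoid {M : Type} [InverseMonoid M] (N : Submonoid M) : Prop :=
  ∀ x ∈ N, x⁻¹ ∈ N

/-- A monogenic inverse submonoid: an inverse submonoid that has an element `m` such that it is
generated, as a monoid, by `m` and `m⁻¹`. -/
def IsMonogenicInverseSubmonoid {M : Type} [InverseMonoid M] (N : Submonoid M) : Prop :=
  IsInverseSubmonoid N ∧ ∃ m ∈ N, N = Submonoid.closure {m, m⁻¹}

theorem PEquiv.trans_symm_trans {α : Type} (f : α ≃. α) : (f.trans f.symm).trans f = f := by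
  refine PEquiv.ext fun a => Option.ext fun b => ?_
  change b ∈ (f.trans f.symm).trans f a ↔ b ∈ f a
  simp only [PEquiv.mem_trans, PEquiv.mem_iff_mem]
  refine ⟨fun ⟨c, ⟨d, hd, hc⟩, hb⟩ => ?_, fun h => ⟨a, ⟨b, h, h⟩, h⟩⟩
  rw [Option.mem_unique hb hc]
  exact hd

theorem PEquiv.le_symm_of_trans {α : Type} (f g : α ≃. α) (h : (g.trans f).trans g = g)
    (a b : α) (hab : b ∈ g a) : a ∈ f b := by
  have h' := hab
  rw [← h] at h'
  simp only [PEquiv.mem_trans] at h'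
  obtain ⟨c, ⟨d, hd, hc⟩, hb⟩ := h'
  rw [Option.mem_unique hd hab] at hc
  rwa [PEquiv.inj g hb hab] at hc

/-- The symmetric inverse monoid `I_n`: all bijections between subsets of an `n`-element set. -/
def SymmetricInverseMonoid (n : ℕ) : Type := Fin n ≃. Fin n

/-- The product of `I_n` is composition of partial bijections from left to right, and the inverse
is the inverse partial bijection. -/
instance (n : ℕ) : InverseMonoid (SymmetricInverseMonoid n) where
  mul f g := PEquiv.trans f g
  one := PEquiv.refl (Fin n)
  inv f := PEquiv.symm f
  mul_assoc f g h := PEquiv.trans_assoc f g h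
  one_mul f := PEquiv.refl_trans f
  mul_one f := PEquiv.trans_refl f
  mul_inv_mul_cancel f := PEquiv.trans_symm_trans f
  inv_mul_inv_cancel f := PEquiv.trans_symm_trans (PEquiv.symm f)
  eq_inv_of_mul f g h₁ h₂ := PEquiv.ext fun a => Option.ext fun b =>
    ⟨fun h => (PEquiv.mem_iff_mem f).2 (PEquiv.le_symm_of_trans f g h₂ a b h),
      fun h => PEquiv.le_symm_of_trans g f h₁ b a ((PEquiv.mem_iff_mem f).1 h)⟩

/-- The number of cyclic subgroups of the symmetric group `S_n`, up to isomorphism. -/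
noncomputable def numCyclicSubgroups (n : ℕ) : ℕ :=
  numIsoClasses fun H : {H : Subgroup (Equiv.Perm (Fin n)) // IsCyclic H} => H.1

/-- The number of monogenic submonoids of the full transformation monoid `T_n`, up to isomorphism.
`Function.End` composes from right to left; the powers of an element, hence the monogenic
submonoids, are the same for both orders of composition. -/
noncomputable def numMonogenicSubmonoids (n : ℕ) : ℕ :=
  numIsoClasses fun N : {N : Submonoid (Function.End (Fin n)) // IsMonogenicMonoid N} => N.1

/-- The number of monogenic inverse submonoids of the symmetric inverse monoid `I_n`, up to
isomorphism. -/
noncomputable def numMonogenicInverseSubmonoids (n : ℕ) : ℕ :=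
  numIsoClasses fun N :
    {N : Submonoid (SymmetricInverseMonoid n) // IsMonogenicInverseSubmonoid N} => N.1

/-- The number of cyclic subgroups of `S_n` up to isomorphism is the number of distinct orders of
elements of `S_n`. -/
theorem numCyclicSubgroups_eq_ncard (n : ℕ) :
    numCyclicSubgroups n = (Set.range fun g : Equiv.Perm (Fin n) => orderOf g).ncard := by
  rw [numCyclicSubgroups, numIsoClasses, ← Nat.card_coe_set_eq]
  let F : {H : Subgroup (Equiv.Perm (Fin n)) // IsCyclic H} →
      (Set.range fun g : Equiv.Perm (Fin n) => orderOf g) := fun H =>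
    ⟨Nat.card H.1, by
      obtain ⟨g, hg⟩ := (Subgroup.isCyclic_iff_exists_zpowers_eq_top H.1).1 H.2
      exact ⟨g, by rw [← hg, Nat.card_zpowers]⟩⟩
  have hF : ∀ H K, (isoSetoid fun H : {H : Subgroup (Equiv.Perm (Fin n)) // IsCyclic H} =>
      H.1).r H K ↔ F H = F K := by
    intro H K
    refine ⟨fun ⟨e⟩ => Subtype.ext (Nat.card_congr e.toEquiv), fun h => ?_⟩
    have := H.2
    have := K.2
    exact ⟨mulEquivOfCyclicCardEq (Subtype.ext_iff.1 h)⟩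
  refine Nat.card_congr (Equiv.ofBijective
    (Quotient.lift F fun H K h => (hF H K).1 h) ⟨?_, ?_⟩)
  · rintro ⟨H⟩ ⟨K⟩ h
    exact Quotient.sound ((hF H K).2 h)
  · rintro ⟨_, g, rfl⟩
    refine ⟨Quotient.mk _ ⟨Subgroup.zpowers g, inferInstance⟩, Subtype.ext ?_⟩
    exact Nat.card_zpowers g

/-! Both counts reduce to counting pairs `(m, r)` of an index and a period. The least `m` and `r >
0` with `x ^ m = x ^ (m + r)` determine all coincidences among powers of a generator `x`. They can
also be read off from the laws `x ^ i = x ^ j` valid in the whole monoid, so they do not depend on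
the generator and are isomorphism invariants. By `numIsoClasses_eq_ncard` it remains to see that
they are complete invariants and to find which pairs occur.

For a transformation `f` of `n` points the images of the powers shrink strictly `m` times; then `f`
permutes the stable image with order `r` (`Function.End.index_add_card_le`). So `r` is the order of
a permutation of at most `n - m` points, and `m < n` because the stable image is nonempty. Attaching
a tail to a permutation realises every such pair.

For a partial bijection the stable part is a core permuted with order `r`, and maximality of the
index gives a disjoint chain of `m` points (`exists_core`, `exists_maximal_chain`). The core may be
empty, so `m = n` is allowed; this is the extra term `s(0) = 1`. Completeness is the deeper point:
an inverse submonoid contains more than powers, so it is presented as a quotient of the free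
monogenic inverse monoid, and `pathAction_eq_iff` shows that the congruence depends only on `m` and
`r`. -/

/-! ### Index and period. -/

/-- The relation between exponents `i` and `j` that holds when `x ^ i = x ^ j` for an element `x` of
index `m` and period `r`. -/
def ExponentRel (m r i j : ℕ) : Prop :=
  i = j ∨ m ≤ i ∧ m ≤ j ∧ i ≡ j [MOD r]

/-- The element `x` has index `m` and period `r`. -/
def HasIndexPeriod {M : Type} [Monoid M] (x : M) (m r : ℕ) : Prop :=
  0 < r ∧ ∀ i j : ℕ, x ^ i = x ^ j ↔ ExponentRel m r i j

/-- The monoid `M` satisfies exactly those laws `x ^ i = x ^ j` that an element of index `m` and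
period `r` satisfies. -/
def Monoid.IsOfIndexPeriod (M : Type) [Monoid M] (m r : ℕ) : Prop :=
  0 < r ∧ ∀ i j : ℕ, (∀ x : M, x ^ i = x ^ j) ↔ ExponentRel m r i j

/-- The single pair `m`, `m + r` already forces both conclusions. -/
theorem ExponentRel.index_le_and_dvd {m r m' r' : ℕ} (hr : 0 < r)
    (h : ∀ i j, ExponentRel m r i j → ExponentRel m' r' i j) : m' ≤ m ∧ r' ∣ r := by
  rcases h m (m + r) (Or.inr ⟨le_rfl, by omega, by simp [Nat.ModEq]⟩) with h | ⟨h1, _, h2⟩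
  · omega
  · refine ⟨h1, ?_⟩
    have := (Nat.modEq_iff_dvd' (by omega)).1 h2
    simpa using this

theorem ExponentRel.unique {m r m' r' : ℕ} (hr : 0 < r) (hr' : 0 < r')
    (h : ∀ i j, ExponentRel m r i j ↔ ExponentRel m' r' i j) : m = m' ∧ r = r' := by
  obtain ⟨h1, h2⟩ := ExponentRel.index_le_and_dvd hr fun i j => (h i j).1
  obtain ⟨h3, h4⟩ := ExponentRel.index_le_and_dvd hr' fun i j => (h i j).2
  exact ⟨le_antisymm h3 h1, Nat.dvd_antisymm h4 h2⟩

theorem Monoid.IsOfIndexPeriod.unique {M : Type} [Monoid M] {m r m' r' : ℕ}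
    (h : Monoid.IsOfIndexPeriod M m r) (h' : Monoid.IsOfIndexPeriod M m' r') :
    m = m' ∧ r = r' :=
  ExponentRel.unique h.1 h'.1 fun i j => (h.2 i j).symm.trans (h'.2 i j)

theorem Monoid.IsOfIndexPeriod.of_mulEquiv {M N : Type} [Monoid M] [Monoid N] (e : M ≃* N)
    {m r : ℕ} (h : Monoid.IsOfIndexPeriod M m r) : Monoid.IsOfIndexPeriod N m r := by
  refine ⟨h.1, fun i j => ?_⟩
  rw [← h.2 i j]
  constructor
  · intro H x
    apply e.injective
    rw [map_pow, map_pow, H]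
  · intro H y
    apply e.symm.injective
    rw [map_pow, map_pow, H]

/-- Every element of a finite monoid has an index and a period. -/
theorem exists_hasIndexPeriod {M : Type} [Monoid M] [Finite M] (x : M) :
    ∃ m r, HasIndexPeriod x m r := by
  classical
  have h0 : ∃ m, ∃ r, 0 < r ∧ x ^ m = x ^ (m + r) := by
    obtain ⟨i, j, hij, h⟩ := Finite.exists_ne_map_eq_of_infinite (fun i : ℕ => x ^ i)
    rcases lt_or_gt_of_ne hij with hlt | hlt
    · exact ⟨i, j - i, by omega, by rw [show i + (j - i) = j by omega]; exact h⟩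
    · exact ⟨j, i - j, by omega, by rw [show j + (i - j) = i by omega]; exact h.symm⟩
  obtain ⟨m, hm, hmin⟩ : ∃ m, (∃ r, 0 < r ∧ x ^ m = x ^ (m + r)) ∧
      ∀ i, (∃ r, 0 < r ∧ x ^ i = x ^ (i + r)) → m ≤ i :=
    ⟨Nat.find h0, Nat.find_spec h0, fun i hi => Nat.find_min' h0 hi⟩
  obtain ⟨r, ⟨hr, hxr⟩, hrmin⟩ : ∃ r, (0 < r ∧ x ^ m = x ^ (m + r)) ∧
      ∀ s, (0 < s ∧ x ^ m = x ^ (m + s)) → r ≤ s :=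
    ⟨Nat.find hm, Nat.find_spec hm, fun i hi => Nat.find_min' hm hi⟩
  have hper : ∀ t i, m ≤ i → x ^ (i + r * t) = x ^ i := by
    intro t
    induction t with
    | zero => simp
    | succ t ih =>
      intro i hi
      rw [show i + r * (t + 1) = (i - m) + (m + r) + r * t by
        rw [Nat.mul_succ]; omega, ih _ (by omega), pow_add, ← hxr, ← pow_add]
      congr 1
      omega
  have hlt : ∀ i j, i < j → (x ^ i = x ^ j ↔ ExponentRel m r i j) := by
    intro i j hij
    constructor
    · intro h
      have hmi : m ≤ i := hmin i ⟨j - i, by omega, by rw [show i + (j - i) = j by omega]; exact h⟩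
      refine Or.inr ⟨hmi, by omega, ?_⟩
      rw [Nat.modEq_iff_dvd' hij.le]
      set d := j - i with hd
      have h1 : x ^ m = x ^ (m + d) := by
        -- Going up by the multiple `r * i` of the period makes room to split off `x ^ i`, which is
        -- then replaced by `x ^ j`.
        have hle : i ≤ r * i := Nat.le_mul_of_pos_left i hr
        rw [← hper i m le_rfl, ← hper i (m + d) (by omega),
          show m + r * i = (m + r * i - i) + i by omega, pow_add, h, ← pow_add]
        congr 1
        omega
      have h2 : x ^ m = x ^ (m + d % r) := by
        rw [← hper (d / r) (m + d % r) (by omega), add_assoc, Nat.mod_add_div]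
        exact h1
      by_contra hnd
      have h3 : 0 < d % r := Nat.pos_of_ne_zero fun h => hnd (Nat.dvd_of_mod_eq_zero h)
      exact absurd (hrmin _ ⟨h3, h2⟩) (not_le.2 (Nat.mod_lt _ hr))
    · rintro (rfl | ⟨h1, -, h3⟩)
      · rfl
      · obtain ⟨t, ht⟩ := (Nat.modEq_iff_dvd' hij.le).1 h3
        rw [show j = i + r * t by omega, hper t i h1]
  refine ⟨m, r, hr, fun i j => ?_⟩
  rcases lt_trichotomy i j with h | rfl | h
  · exact hlt i j h
  · exact ⟨fun _ => Or.inl rfl, fun _ => rfl⟩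
  · rw [eq_comm, hlt j i h]
    constructor
    · rintro (h | ⟨h1, h2, h3⟩)
      · exact Or.inl h.symm
      · exact Or.inr ⟨h2, h1, h3.symm⟩
    · rintro (h | ⟨h1, h2, h3⟩)
      · exact Or.inl h.symm
      · exact Or.inr ⟨h2, h1, h3.symm⟩

/-- An element has index `m` and period `r` as soon as `x ^ i = x ^ j` is decided for `i < j`. -/
theorem hasIndexPeriod_of_lt {M : Type} [Monoid M] {x : M} {m r : ℕ} (hr : 0 < r)
    (h : ∀ i j, i < j → (x ^ i = x ^ j ↔ m ≤ i ∧ i ≡ j [MOD r])) : HasIndexPeriod x m r := by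
  refine ⟨hr, fun i j => ?_⟩
  rcases lt_trichotomy i j with hij | rfl | hij
  · rw [h i j hij]
    exact ⟨fun H => Or.inr ⟨H.1, by omega, H.2⟩, fun H => H.elim (by omega) fun H => ⟨H.1, H.2.2⟩⟩
  · exact ⟨fun _ => Or.inl rfl, fun _ => rfl⟩
  · rw [eq_comm, h j i hij]
    exact ⟨fun H => Or.inr ⟨by omega, H.1, H.2.symm⟩,
      fun H => H.elim (by omega) fun H => ⟨H.2.1, H.2.2.symm⟩⟩

/-! ### Counting isomorphism classes by index and period. -/

/-- Two quotients of a monoid by the same congruence are isomorphic. -/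
theorem nonempty_mulEquiv_of_ker_eq {A M N : Type} [Monoid A] [Monoid M] [Monoid N]
    (φ : A →* M) (ψ : A →* N) (hφ : Function.Surjective φ) (hψ : Function.Surjective ψ)
    (h : ∀ a b, φ a = φ b ↔ ψ a = ψ b) : Nonempty (M ≃* N) := by
  have hker : Con.ker φ = Con.ker ψ := Con.ext fun a b => h a b
  have e := Con.quotientKerEquivOfSurjective φ hφ
  rw [hker] at e
  exact ⟨e.symm.trans (Con.quotientKerEquivOfSurjective ψ hψ)⟩

/-- Index and period are defined by laws, hence constant on isomorphism classes; `hiso` makes them a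
complete invariant, and `hF` says that every pair in `S` occurs. -/
theorem numIsoClasses_eq_ncard {ι : Type} (F : ι → Type) [∀ i, Monoid (F i)] (S : Set (ℕ × ℕ))
    (hS : ∀ i, ∃ p ∈ S, Monoid.IsOfIndexPeriod (F i) p.1 p.2)
    (hF : ∀ p ∈ S, ∃ i, Monoid.IsOfIndexPeriod (F i) p.1 p.2)
    (hiso : ∀ i j m r, Monoid.IsOfIndexPeriod (F i) m r → Monoid.IsOfIndexPeriod (F j) m r →
      Nonempty (F i ≃* F j)) :
    numIsoClasses F = S.ncard := by
  choose p hpS hp using hS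
  rw [numIsoClasses, ← Nat.card_coe_set_eq]
  have hr : ∀ i j, (isoSetoid F).r i j ↔ (⟨p i, hpS i⟩ : S) = ⟨p j, hpS j⟩ := by
    intro i j
    rw [Subtype.mk.injEq]
    constructor
    · rintro ⟨e⟩
      have := ((hp i).of_mulEquiv e).unique (hp j)
      exact Prod.ext this.1 this.2
    · intro h
      exact hiso i j _ _ (hp i) (h ▸ hp j)
  refine Nat.card_congr (Equiv.ofBijective
    (Quotient.lift (fun i => (⟨p i, hpS i⟩ : S)) fun i j h => (hr i j).1 h) ⟨?_, ?_⟩)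
  · rintro ⟨i⟩ ⟨j⟩ h
    exact Quotient.sound ((hr i j).2 h)
  · rintro ⟨q, hq⟩
    obtain ⟨i, hi⟩ := hF q hq
    refine ⟨Quotient.mk _ i, Subtype.ext ?_⟩
    have := (hp i).unique hi
    exact Prod.ext this.1 this.2

/-- The orders of the permutations of `n` points. -/
def permOrders (n : ℕ) : Set ℕ := Set.range fun g : Equiv.Perm (Fin n) => orderOf g

theorem orderOf_mem_permOrders {α : Type} [Fintype α] {n : ℕ} (h : Fintype.card α ≤ n)
    (g : Equiv.Perm α) : orderOf g ∈ permOrders n := by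
  obtain ⟨f⟩ := Function.Embedding.nonempty_of_card_le (β := Fin n) (by simpa using h)
  exact ⟨Equiv.Perm.viaEmbeddingHom f g,
    orderOf_injective _ (Equiv.Perm.viaEmbeddingHom_injective f) g⟩

theorem ncard_indexPeriod (n N : ℕ) :
    {p : ℕ × ℕ | p.1 < N ∧ p.2 ∈ permOrders (n - p.1)}.ncard =
      ∑ m ∈ Finset.range N, numCyclicSubgroups (n - m) := by
  have hfin : ∀ k, Finite (permOrders k) := fun k => Set.finite_range _
  let e : {p : ℕ × ℕ | p.1 < N ∧ p.2 ∈ permOrders (n - p.1)} ≃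
      Σ m : Fin N, permOrders (n - m) :=
    { toFun := fun p => ⟨⟨p.1.1, p.2.1⟩, ⟨p.1.2, p.2.2⟩⟩
      invFun := fun q => ⟨(q.1.1, q.2.1), q.1.2, q.2.2⟩
      left_inv := fun _ => rfl
      right_inv := fun _ => rfl }
  rw [← Nat.card_coe_set_eq, Nat.card_congr e, Nat.card_sigma,
    Finset.sum_range fun m => numCyclicSubgroups (n - m)]
  refine Finset.sum_congr rfl fun m _ => ?_
  rw [numCyclicSubgroups_eq_ncard, Nat.card_coe_set_eq]
  rfl

/-! ### Monogenic submonoids of the full transformation monoid. -/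

/-- A law in one variable that holds at the generator holds at its powers, since exponents commute.
-/
theorem Monoid.isOfIndexPeriod_of_powers {M : Type} [Monoid M] {x : M}
    (hx : ∀ y : M, ∃ k : ℕ, y = x ^ k) {m r : ℕ} :
    Monoid.IsOfIndexPeriod M m r ↔ HasIndexPeriod x m r := by
  have h : ∀ i j : ℕ, (∀ y : M, y ^ i = y ^ j) ↔ x ^ i = x ^ j := by
    intro i j
    refine ⟨fun h => h x, fun h y => ?_⟩
    obtain ⟨k, rfl⟩ := hx y
    rw [← pow_mul, ← pow_mul, mul_comm, mul_comm k, pow_mul, pow_mul, h]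
  simp only [Monoid.IsOfIndexPeriod, HasIndexPeriod, h]

/-- Both monoids are quotients of the additive monoid `ℕ` by the congruence `ExponentRel m r`. -/
theorem IsMonogenicMonoid.nonempty_mulEquiv {M N : Type} [Monoid M] [Monoid N]
    (hM : IsMonogenicMonoid M) (hN : IsMonogenicMonoid N) {m r : ℕ}
    (h : Monoid.IsOfIndexPeriod M m r) (h' : Monoid.IsOfIndexPeriod N m r) :
    Nonempty (M ≃* N) := by
  obtain ⟨x, hx⟩ := hM
  obtain ⟨y, hy⟩ := hN
  rw [Monoid.isOfIndexPeriod_of_powers hx] at h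
  rw [Monoid.isOfIndexPeriod_of_powers hy] at h'
  refine nonempty_mulEquiv_of_ker_eq (powersHom M x) (powersHom N y) (fun z => ?_) (fun z => ?_)
    fun a b => ?_
  · obtain ⟨k, rfl⟩ := hx z
    exact ⟨Multiplicative.ofAdd k, rfl⟩
  · obtain ⟨k, rfl⟩ := hy z
    exact ⟨Multiplicative.ofAdd k, rfl⟩
  · exact (h.2 _ _).trans (h'.2 _ _).symm

theorem HasIndexPeriod.coe_iff {M : Type} [Monoid M] {N : Submonoid M} {x : N} {m r : ℕ} :
    HasIndexPeriod (x : M) m r ↔ HasIndexPeriod x m r := by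
  simp only [HasIndexPeriod, ← SubmonoidClass.coe_pow, Subtype.coe_inj]

/-- A transformation of index `m` and period `r` permutes the range of its `m`-th power, with
order `r`, and this range omits at least `m` points. -/
theorem Function.End.index_add_card_le {n : ℕ} {f : Function.End (Fin n)} {m r : ℕ}
    (h : HasIndexPeriod f m r) :
    ∃ P : Finset (Fin n), P.card + m ≤ n ∧ (0 < n → P.Nonempty) ∧ r ∈ permOrders P.card := by
  classical
  let R : ℕ → Finset (Fin n) := fun i => Finset.univ.image fun y => (f ^ i) y
  have hR : ∀ i x, x ∈ R i ↔ ∃ y, (f ^ i) y = x := fun i x => by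
    simp only [R, Finset.mem_image, Finset.mem_univ, true_and]
  have hsucc : ∀ i, R (i + 1) ⊆ R i := by
    intro i x hx
    obtain ⟨y, rfl⟩ := (hR _ _).1 hx
    exact (hR _ _).2 ⟨f y, rfl⟩
  have hmaps : ∀ i, ∀ x ∈ R i, f x ∈ R (i + 1) := by
    intro i x hx
    obtain ⟨y, rfl⟩ := (hR _ _).1 hx
    refine (hR _ _).2 ⟨y, ?_⟩
    rw [pow_succ']
    rfl
  have hsurj : ∀ i, ∀ x ∈ R (i + 1), ∃ y ∈ R i, f y = x := by
    intro i x hx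
    obtain ⟨y, rfl⟩ := (hR _ _).1 hx
    refine ⟨(f ^ i) y, (hR _ _).2 ⟨y, rfl⟩, ?_⟩
    rw [pow_succ']
    rfl
  have hperm : ∀ i, R (i + 1) = R i → ∃ π : Equiv.Perm (R i), ∀ x, (π x : Fin n) = f x := by
    intro i hi
    let g : R i → R i := fun x => ⟨f x, by
      have := hmaps i x x.2
      rwa [hi] at this⟩
    have hg : Function.Surjective g := by
      rintro ⟨x, hx⟩
      obtain ⟨y, hy, hyx⟩ := hsurj i x (hi.symm ▸ hx)
      exact ⟨⟨y, hy⟩, Subtype.ext hyx⟩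
    exact ⟨Equiv.ofBijective g ⟨Finite.injective_iff_surjective.2 hg, hg⟩, fun x => rfl⟩
  have hpow : ∀ i (π : Equiv.Perm (R i)), (∀ x, (π x : Fin n) = f x) → ∀ k,
      π ^ k = 1 ↔ f ^ i = f ^ (i + k) := by
    intro i π hπ k
    have hk : ∀ k x, ((π ^ k) x : Fin n) = (f ^ k) x := by
      intro k
      induction k with
      | zero => intro x; rfl
      | succ k ih =>
        intro x
        rw [pow_succ, pow_succ, Equiv.Perm.mul_apply, ih, hπ]
        rfl
    constructor
    · intro h
      funext x
      have := hk k ⟨(f ^ i) x, (hR _ _).2 ⟨x, rfl⟩⟩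
      rw [h] at this
      rw [add_comm, pow_add]
      exact this
    · intro h
      ext ⟨x, hx⟩
      obtain ⟨y, rfl⟩ := (hR _ _).1 hx
      rw [hk]
      rw [add_comm, pow_add] at h
      exact congrArg Fin.val (congrFun h y).symm
  -- If the image stalled at `i < m`, then `f` would permute it, and the order of that permutation
  -- would give a coincidence of powers starting below the index.
  have hstrict : ∀ i, i < m → (R (i + 1)).card < (R i).card := by
    intro i hi
    refine Finset.card_lt_card ((hsucc i).lt_of_ne fun heq => ?_)
    obtain ⟨π, hπ⟩ := hperm i heq
    have h1 := (hpow i π hπ (orderOf π)).1 (pow_orderOf_eq_one π)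
    rcases (h.2 _ _).1 h1 with h2 | h2
    · have := orderOf_pos π
      omega
    · omega
  have hcard : ∀ i, i ≤ m → (R i).card + i ≤ n := by
    intro i
    induction i with
    | zero => exact fun _ => by simpa using Finset.card_le_univ (R 0)
    | succ i ih =>
      intro hi
      have := ih (by omega)
      have := hstrict i (by omega)
      omega
  refine ⟨R m, hcard m le_rfl, fun hn => ⟨(f ^ m) ⟨0, hn⟩, (hR _ _).2 ⟨_, rfl⟩⟩, ?_⟩
  have hRr : f ^ m = f ^ (m + r) := (h.2 _ _).2 (Or.inr ⟨le_rfl, by omega, by simp [Nat.ModEq]⟩)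
  -- The decreasing images are squeezed: `R (m + r) ⊆ R (m + 1) ⊆ R m`, and the outer two agree.
  have hRm : R (m + 1) = R m := by
    refine (hsucc m).antisymm ?_
    have hadd : ∀ k, R (m + 1 + k) ⊆ R (m + 1) := by
      intro k
      induction k with
      | zero => exact subset_rfl
      | succ k ih => exact (hsucc _).trans ih
    have := hadd (r - 1)
    rw [show m + 1 + (r - 1) = m + r by have := h.1; omega] at this
    simpa only [R, ← hRr] using this
  obtain ⟨π, hπ⟩ := hperm m hRm
  have hord : orderOf π = r := by
    refine Nat.dvd_antisymm (orderOf_dvd_of_pow_eq_one ((hpow m π hπ r).2 hRr)) ?_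
    have h1 := (hpow m π hπ _).1 (pow_orderOf_eq_one π)
    rcases (h.2 _ _).1 h1 with h2 | ⟨-, -, h2⟩
    · have := orderOf_pos π
      omega
    · simpa using (Nat.modEq_iff_dvd' (by omega)).1 h2
  rw [← hord]
  exact orderOf_mem_permOrders (by simp) π

theorem permOrders_mono {a b : ℕ} (h : a ≤ b) : permOrders a ⊆ permOrders b := by
  rintro _ ⟨g, rfl⟩
  exact orderOf_mem_permOrders (by simpa using h) g

/-- The transformation that acts as `g` on the first `c` points and moves all later points one step
down. -/
def permWithTail {c n : ℕ} (hc : 0 < c) (hcn : c ≤ n) (g : Equiv.Perm (Fin c)) :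
    Function.End (Fin n) := fun x =>
  if h : x.1 < c then Fin.castLE hcn (g ⟨x, h⟩) else ⟨x - 1, by omega⟩

theorem permWithTail_pow_castLE {c n : ℕ} (hc : 0 < c) (hcn : c ≤ n) (g : Equiv.Perm (Fin c))
    (k : ℕ) (x : Fin c) :
    (permWithTail hc hcn g ^ k) (Fin.castLE hcn x) = Fin.castLE hcn ((g ^ k) x) := by
  induction k generalizing x with
  | zero => rfl
  | succ k ih =>
    have h1 : permWithTail hc hcn g (Fin.castLE hcn x) = Fin.castLE hcn (g x) := by
      simp [permWithTail]
    rw [pow_succ, pow_succ, Equiv.Perm.mul_apply, ← ih, ← h1]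
    rfl

theorem permWithTail_pow_of_le {c n : ℕ} (hc : 0 < c) (hcn : c ≤ n) (g : Equiv.Perm (Fin c))
    (k : ℕ) (x : Fin n) (hx : c + k ≤ x + 1) :
    ((permWithTail hc hcn g ^ k) x : ℕ) = x - k := by
  induction k generalizing x with
  | zero => rfl
  | succ k ih =>
    have h1 : (permWithTail hc hcn g x : ℕ) = x - 1 := by
      simp only [permWithTail]
      rw [dif_neg (by omega)]
    rw [pow_succ]
    change ((permWithTail hc hcn g ^ k) (permWithTail hc hcn g x) : ℕ) = _
    rw [ih _ (by omega), h1]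
    omega

theorem exists_castLE_eq {c n : ℕ} (hcn : c ≤ n) (x : Fin n) (hx : x.1 < c) :
    ∃ y : Fin c, x = Fin.castLE hcn y := ⟨⟨x, hx⟩, rfl⟩

theorem permWithTail_pow_lt {c n : ℕ} (hc : 0 < c) (hcn : c ≤ n) (g : Equiv.Perm (Fin c))
    (k : ℕ) (x : Fin n) (hx : x.1 < c + k) :
    ((permWithTail hc hcn g ^ k) x : ℕ) < c := by
  induction k generalizing x with
  | zero => exact hx
  | succ k ih =>
    rw [pow_succ]
    change ((permWithTail hc hcn g ^ k) (permWithTail hc hcn g x) : ℕ) < c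
    apply ih
    simp only [permWithTail]
    split_ifs with h
    · simp only [Fin.val_castLE]; omega
    · simp only; omega

/-- The last point needs exactly `n - c` steps to reach the first `c` points, and after that many
steps every point is there, where only `g` acts. -/
theorem hasIndexPeriod_permWithTail {c n : ℕ} (hc : 0 < c) (hcn : c ≤ n)
    (g : Equiv.Perm (Fin c)) :
    HasIndexPeriod (permWithTail hc hcn g) (n - c) (orderOf g) := by
  refine hasIndexPeriod_of_lt (orderOf_pos g) fun i j hij => ?_
  constructor
  · intro h
    constructor
    · by_contra! hi
      have h1 := permWithTail_pow_of_le hc hcn g i ⟨n - 1, by omega⟩ (by simp only; omega)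
      rw [h] at h1
      rcases Nat.lt_or_ge (n - 1) (c + j) with h2 | h2
      · have := permWithTail_pow_lt hc hcn g j ⟨n - 1, by omega⟩ h2
        simp only at h1
        omega
      · have := permWithTail_pow_of_le hc hcn g j ⟨n - 1, by omega⟩ (by simp only; omega)
        simp only at this h1
        omega
    · rw [← pow_eq_pow_iff_modEq]
      ext x
      have := congrFun h (Fin.castLE hcn x)
      rw [permWithTail_pow_castLE, permWithTail_pow_castLE] at this
      simpa using congrArg Fin.val this
  · rintro ⟨h1, h2⟩
    have hg := pow_eq_pow_iff_modEq.2 h2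
    -- The first `n - c` steps are spent on entering the permuted points; only the remaining steps
    -- are compared.
    have h3 : g ^ (i - (n - c)) = g ^ (j - (n - c)) := by
      rw [pow_eq_pow_iff_modEq]
      refine Nat.ModEq.add_right_cancel' (n - c) ?_
      rwa [Nat.sub_add_cancel h1, Nat.sub_add_cancel (by omega)]
    funext x
    obtain ⟨y, hy⟩ := exists_castLE_eq hcn _
      (permWithTail_pow_lt hc hcn g (n - c) x (by omega))
    have key : ∀ k, n - c ≤ k → (permWithTail hc hcn g ^ k) x =
        Fin.castLE hcn ((g ^ (k - (n - c))) y) := by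
      intro k hk
      rw [← permWithTail_pow_castLE hc, ← hy]
      conv_lhs => rw [← Nat.sub_add_cancel hk, pow_add]
      rfl
    rw [key i h1, key j (by omega), h3]

/-- The stable image is nonempty, so the index is at most `n - 1` and the term `s(0)` is absent. -/
theorem numMonogenicSubmonoids_eq_sum {n : ℕ} (hn : 0 < n) :
    numMonogenicSubmonoids n = ∑ m ∈ Finset.range n, numCyclicSubgroups (n - m) := by
  rw [← ncard_indexPeriod, numMonogenicSubmonoids]
  have : Finite (Function.End (Fin n)) := inferInstanceAs (Finite (Fin n → Fin n))
  refine numIsoClasses_eq_ncard _ _ ?_ ?_ ?_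
  · rintro ⟨N, x, hx⟩
    obtain ⟨m, r, h⟩ := exists_hasIndexPeriod (x : Function.End (Fin n))
    refine ⟨(m, r), ?_, (Monoid.isOfIndexPeriod_of_powers hx).2 (HasIndexPeriod.coe_iff.1 h)⟩
    obtain ⟨P, h1, h2, h3⟩ := Function.End.index_add_card_le h
    have := (h2 hn).card_pos
    exact ⟨by simp only; omega, permOrders_mono (by simp only; omega) h3⟩
  · rintro ⟨m, r⟩ ⟨h1, g, hg⟩
    simp only at h1 hg g
    have h := hasIndexPeriod_permWithTail (n := n) (by omega) (by omega) g
    rw [hg, Nat.sub_sub_self h1.le] at h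
    set f := permWithTail (n := n) (by omega) (by omega) g
    have hx : ∀ y : Submonoid.powers f, ∃ k : ℕ,
        y = (⟨f, Submonoid.mem_powers f⟩ : Submonoid.powers f) ^ k := by
      rintro ⟨_, k, rfl⟩
      exact ⟨k, Subtype.ext rfl⟩
    exact ⟨⟨Submonoid.powers f, _, hx⟩,
      (Monoid.isOfIndexPeriod_of_powers hx).2
        ((HasIndexPeriod.coe_iff (x := ⟨f, Submonoid.mem_powers f⟩)).1 h)⟩
  · rintro ⟨M, hM⟩ ⟨N, hN⟩ m r h h'
    exact hM.nonempty_mulEquiv hN h h'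

/-! ### Partial bijections through their graphs. -/

namespace SymmetricInverseMonoid

variable {n : ℕ}

/-- The graph of a partial bijection. -/
def Rel (f : SymmetricInverseMonoid n) (u v : Fin n) : Prop :=
  v ∈ PEquiv.toFun f u

theorem ext_rel {f g : SymmetricInverseMonoid n} (h : ∀ u v, f.Rel u v ↔ g.Rel u v) : f = g :=
  PEquiv.ext fun u => Option.ext fun v => h u v

theorem rel_one {u v : Fin n} : (1 : SymmetricInverseMonoid n).Rel u v ↔ u = v := by
  change v ∈ some u ↔ _
  simp

theorem rel_mul {f g : SymmetricInverseMonoid n} {u v : Fin n} :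
    (f * g).Rel u v ↔ ∃ w, f.Rel u w ∧ g.Rel w v :=
  PEquiv.mem_trans (f : Fin n ≃. Fin n) (g : Fin n ≃. Fin n) u v

theorem rel_inv {f : SymmetricInverseMonoid n} {u v : Fin n} : f⁻¹.Rel u v ↔ f.Rel v u :=
  PEquiv.mem_iff_mem (f : Fin n ≃. Fin n)

theorem Rel.right_unique {f : SymmetricInverseMonoid n} {u v w : Fin n} (h : f.Rel u v)
    (h' : f.Rel u w) : v = w :=
  Option.mem_unique h h'

theorem Rel.left_unique {f : SymmetricInverseMonoid n} {u v w : Fin n} (h : f.Rel u w)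
    (h' : f.Rel v w) : u = v :=
  PEquiv.inj f h h'

open Classical in
/-- The partial bijection with a given graph. -/
noncomputable def ofRel (R : Fin n → Fin n → Prop) (h₁ : ∀ u v w, R u v → R u w → v = w)
    (h₂ : ∀ u v w, R u w → R v w → u = v) : SymmetricInverseMonoid n where
  toFun u := if h : ∃ v, R u v then some h.choose else none
  invFun v := if h : ∃ u, R u v then some h.choose else none
  inv u v := by
    constructor
    · intro h
      split_ifs at h with h'
      · obtain rfl : h'.choose = u := by simpa using h
        have h3 : ∃ w, R h'.choose w := ⟨v, h'.choose_spec⟩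
        rw [dif_pos h3]
        exact congrArg some (h₁ _ _ _ h3.choose_spec h'.choose_spec)
    · intro h
      split_ifs at h with h'
      · obtain rfl : h'.choose = v := by simpa using h
        have h3 : ∃ w, R w h'.choose := ⟨u, h'.choose_spec⟩
        rw [dif_pos h3]
        exact congrArg some (h₂ _ _ _ h3.choose_spec h'.choose_spec)

theorem rel_ofRel {R : Fin n → Fin n → Prop} {h₁ : ∀ u v w, R u v → R u w → v = w}
    {h₂ : ∀ u v w, R u w → R v w → u = v} {u v : Fin n} : (ofRel R h₁ h₂).Rel u v ↔ R u v := by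
  classical
  change v ∈ (if h : ∃ v, R u v then some h.choose else none) ↔ _
  split_ifs with h
  · rw [Option.mem_some_iff]
    exact ⟨fun h' => h' ▸ h.choose_spec, fun h' => h₁ _ _ _ h.choose_spec h'⟩
  · simp only [Option.mem_def, reduceCtorEq, false_iff]
    exact fun h' => h ⟨v, h'⟩

/-- Every partial bijection is the restriction of a permutation. -/
theorem exists_perm_rel (f : SymmetricInverseMonoid n) :
    ∃ (σ : Equiv.Perm (Fin n)) (D : Set (Fin n)), ∀ u v, f.Rel u v ↔ u ∈ D ∧ σ u = v := by
  classical
  let s : Set (Fin n) := {u | ∃ v, f.Rel u v}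
  let F : Fin n → Fin n := fun u => if h : ∃ v, f.Rel u v then h.choose else u
  have hF : ∀ u ∈ s, f.Rel u (F u) := by
    intro u hu
    simp only [F]
    rw [dif_pos (show ∃ v, f.Rel u v from hu)]
    exact hu.choose_spec
  obtain ⟨g, hg⟩ := Set.MapsTo.exists_equiv_extend_of_card_eq (t := Finset.univ) (s := s) (f := F)
    (by simp) (fun _ _ => by simp)
    (fun u hu v hv huv => (hF u hu).left_unique (huv ▸ hF v hv))
  refine ⟨g.trans (Equiv.subtypeUnivEquiv Finset.mem_univ), s, fun u v => ?_⟩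
  constructor
  · intro h
    have hu : u ∈ s := ⟨v, h⟩
    exact ⟨hu, (hg u hu).trans ((hF u hu).right_unique h)⟩
  · rintro ⟨hu, rfl⟩
    have := hF u hu
    rw [← hg u hu] at this
    exact this

instance : Finite (SymmetricInverseMonoid n) :=
  Finite.of_injective (fun f => {p : Fin n × Fin n | f.Rel p.1 p.2}) fun _ _ h =>
    ext_rel fun u v => Set.ext_iff.1 h (u, v)

end SymmetricInverseMonoid

/-! ### The free monogenic inverse monoid and its congruences. -/

/-- The free monogenic inverse monoid: a path on the integers that starts at `0`, ends at `disp`,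
and covers the interval from `lo` to `hi`. -/
@[ext]
structure FreeMonogenicInverseMonoid : Type where
  lo : ℤ
  hi : ℤ
  disp : ℤ
  lo_nonpos : lo ≤ 0
  hi_nonneg : 0 ≤ hi
  lo_le_disp : lo ≤ disp
  disp_le_hi : disp ≤ hi

namespace FreeMonogenicInverseMonoid

instance : Mul FreeMonogenicInverseMonoid where
  mul s t :=
    { lo := min s.lo (s.disp + t.lo)
      hi := max s.hi (s.disp + t.hi)
      disp := s.disp + t.disp
      lo_nonpos := by have := s.lo_nonpos; omega
      hi_nonneg := by have := s.hi_nonneg; omega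
      lo_le_disp := by have := t.lo_le_disp; omega
      disp_le_hi := by have := t.disp_le_hi; omega }

instance : One FreeMonogenicInverseMonoid where
  one := ⟨0, 0, 0, le_rfl, le_rfl, le_rfl, le_rfl⟩

@[simp] theorem lo_mul (s t : FreeMonogenicInverseMonoid) :
    (s * t).lo = min s.lo (s.disp + t.lo) := rfl
@[simp] theorem hi_mul (s t : FreeMonogenicInverseMonoid) :
    (s * t).hi = max s.hi (s.disp + t.hi) := rfl
@[simp] theorem disp_mul (s t : FreeMonogenicInverseMonoid) :
    (s * t).disp = s.disp + t.disp := rfl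
@[simp] theorem lo_one : (1 : FreeMonogenicInverseMonoid).lo = 0 := rfl
@[simp] theorem hi_one : (1 : FreeMonogenicInverseMonoid).hi = 0 := rfl
@[simp] theorem disp_one : (1 : FreeMonogenicInverseMonoid).disp = 0 := rfl

instance : Monoid FreeMonogenicInverseMonoid where
  mul_assoc s t u := by
    ext <;> simp only [lo_mul, hi_mul, disp_mul] <;> omega
  one_mul s := by
    have := s.lo_nonpos; have := s.hi_nonneg
    ext <;> simp <;> omega
  mul_one s := by
    have := s.lo_le_disp; have := s.disp_le_hi
    ext <;> simp <;> omega

/-- The generator of the free monogenic inverse monoid: one step to the right. -/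
def gen : FreeMonogenicInverseMonoid := ⟨0, 1, 1, by simp, by simp, by simp, by simp⟩

@[simp] theorem lo_gen : gen.lo = 0 := rfl
@[simp] theorem hi_gen : gen.hi = 1 := rfl
@[simp] theorem disp_gen : gen.disp = 1 := rfl

/-- The inverse of the generator: one step to the left. -/
def genInv : FreeMonogenicInverseMonoid := ⟨-1, 0, -1, by simp, by simp, by simp, by simp⟩

@[simp] theorem lo_genInv : genInv.lo = -1 := rfl
@[simp] theorem hi_genInv : genInv.hi = 0 := rfl
@[simp] theorem disp_genInv : genInv.disp = -1 := rfl

theorem gen_pow (k : ℕ) : (gen ^ k).lo = 0 ∧ (gen ^ k).hi = k ∧ (gen ^ k).disp = k := by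
  induction k with
  | zero => simp
  | succ k ih =>
    obtain ⟨h1, h2, h3⟩ := ih
    simp only [pow_succ, lo_mul, hi_mul, disp_mul, h1, h2, h3, lo_gen, hi_gen, disp_gen]
    push_cast
    omega

theorem genInv_pow (k : ℕ) :
    (genInv ^ k).lo = -k ∧ (genInv ^ k).hi = 0 ∧ (genInv ^ k).disp = -k := by
  induction k with
  | zero => simp
  | succ k ih =>
    obtain ⟨h1, h2, h3⟩ := ih
    simp only [pow_succ, lo_mul, hi_mul, disp_mul, h1, h2, h3, lo_genInv, hi_genInv,
      disp_genInv]
    push_cast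
    omega

/-- Walk left to `lo`, then right to `hi`, then back to `disp`: this path covers the same interval
and has the same end. -/
theorem eq_mul_pow (t : FreeMonogenicInverseMonoid) :
    t = genInv ^ (-t.lo).toNat * gen ^ (t.hi - t.lo).toNat * genInv ^ (t.hi - t.disp).toNat := by
  have := t.lo_nonpos
  have := t.hi_nonneg
  have := t.lo_le_disp
  have := t.disp_le_hi
  obtain ⟨a1, a2, a3⟩ := genInv_pow (-t.lo).toNat
  obtain ⟨b1, b2, b3⟩ := gen_pow (t.hi - t.lo).toNat
  obtain ⟨c1, c2, c3⟩ := genInv_pow (t.hi - t.disp).toNat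
  ext <;> simp only [lo_mul, hi_mul, disp_mul, a1, a2, a3, b1, b2, b3, c1, c2, c3] <;> omega

theorem closure_gen : Submonoid.closure {gen, genInv} = ⊤ := by
  rw [eq_top_iff]
  intro t _
  rw [eq_mul_pow t]
  have h1 : gen ∈ Submonoid.closure {gen, genInv} := Submonoid.subset_closure (by simp)
  have h2 : genInv ∈ Submonoid.closure {gen, genInv} := Submonoid.subset_closure (by simp)
  exact mul_mem (mul_mem (pow_mem h2 _) (pow_mem h1 _)) (pow_mem h2 _)

theorem disp_pow (t : FreeMonogenicInverseMonoid) (k : ℕ) : (t ^ k).disp = k * t.disp := by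
  induction k with
  | zero => simp
  | succ k ih =>
    rw [pow_succ, disp_mul, ih]
    push_cast
    ring

theorem pow_eq_self_of_disp_eq_zero {t : FreeMonogenicInverseMonoid} (h : t.disp = 0) {k : ℕ}
    (hk : k ≠ 0) : t ^ k = t := by
  have h1 : t * t = t := by ext <;> simp [h]
  exact IsIdempotentElem.pow_eq h1 hk

/-- The congruence on the free monogenic inverse monoid that determines the quotient of index `m`
and period `r`. -/
def IndexPeriodRel (m r : ℕ) (s t : FreeMonogenicInverseMonoid) : Prop :=
  s = t ∨ (m ≤ s.hi - s.lo ∧ m ≤ t.hi - t.lo ∧ s.disp ≡ t.disp [ZMOD r])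

theorem indexPeriodRel_gen_pow {m r i j : ℕ} :
    IndexPeriodRel m r (gen ^ i) (gen ^ j) ↔ ExponentRel m r i j := by
  obtain ⟨a1, a2, a3⟩ := gen_pow i
  obtain ⟨b1, b2, b3⟩ := gen_pow j
  have h : gen ^ i = gen ^ j ↔ i = j := by
    refine ⟨fun h => ?_, fun h => h ▸ rfl⟩
    have := congrArg disp h
    rw [a3, b3] at this
    exact_mod_cast this
  rw [IndexPeriodRel, ExponentRel, h, a1, a2, a3, b1, b2, b3, Int.natCast_modEq_iff]
  simp

/-- A path with nonzero displacement widens by at least one with each factor, so its powers reach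
width `m`; a path with zero displacement is idempotent. -/
theorem indexPeriodRel_pow {m r i j : ℕ} (h : ExponentRel m r i j)
    (t : FreeMonogenicInverseMonoid) : IndexPeriodRel m r (t ^ i) (t ^ j) := by
  rcases h with rfl | ⟨hi, hj, hij⟩
  · exact Or.inl rfl
  have h0 : ∀ k : ℕ, 0 ≤ (t ^ k).hi - (t ^ k).lo := fun k => by
    have := (t ^ k).lo_nonpos
    have := (t ^ k).hi_nonneg
    omega
  have hmod : (t ^ i).disp ≡ (t ^ j).disp [ZMOD r] := by
    rw [disp_pow, disp_pow]
    exact (Int.natCast_modEq_iff.2 hij).mul_right _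
  -- For `m = 0` an exponent may be `0`, and then idempotence does not help; but the width condition
  -- is vacuous.
  rcases Nat.eq_zero_or_pos m with rfl | hm
  · exact Or.inr ⟨by simpa using h0 i, by simpa using h0 j, hmod⟩
  by_cases hd : t.disp = 0
  · left
    rw [pow_eq_self_of_disp_eq_zero hd (by omega), pow_eq_self_of_disp_eq_zero hd (by omega)]
  · have h1 : ∀ k : ℕ, (k : ℤ) ≤ (t ^ k).hi - (t ^ k).lo := by
      intro k
      have h2 := (t ^ k).lo_nonpos
      have h3 := (t ^ k).hi_nonneg
      have h4 := (t ^ k).lo_le_disp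
      have h5 := (t ^ k).disp_le_hi
      rw [disp_pow] at h4 h5
      rcases lt_or_gt_of_ne hd with h | h
      · nlinarith
      · nlinarith
    exact Or.inr ⟨le_trans (by exact_mod_cast hi) (h1 i), le_trans (by exact_mod_cast hj) (h1 j),
      hmod⟩

end FreeMonogenicInverseMonoid

/-! ### The action of paths by partial bijections. -/

namespace SymmetricInverseMonoid

open FreeMonogenicInverseMonoid

variable {n : ℕ}

/-- The action of a path: the restriction of a power of `σ` to the points from which the path stays
in `D`. -/
noncomputable def pathMap (σ : Equiv.Perm (Fin n)) (D : Set (Fin n))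
    (t : FreeMonogenicInverseMonoid) : SymmetricInverseMonoid n :=
  -- The edge from `l` to `l + 1` can be used, in either direction, exactly when `(σ ^ l) u ∈ D`;
  -- hence the half-open interval.
  ofRel (fun u v => (∀ l, t.lo ≤ l → l < t.hi → (σ ^ l) u ∈ D) ∧ (σ ^ t.disp) u = v)
    (fun _ _ _ h h' => h.2.symm.trans h'.2)
    (fun _ _ _ h h' => (σ ^ t.disp).injective (h.2.trans h'.2.symm))

theorem rel_pathMap {σ : Equiv.Perm (Fin n)} {D : Set (Fin n)} {t : FreeMonogenicInverseMonoid}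
    {u v : Fin n} : (pathMap σ D t).Rel u v ↔
      (∀ l, t.lo ≤ l → l < t.hi → (σ ^ l) u ∈ D) ∧ (σ ^ t.disp) u = v := by
  rw [pathMap, rel_ofRel]

/-- The action of the free monogenic inverse monoid in which the generator acts as the restriction
of `σ` to `D`. -/
noncomputable def pathAction (σ : Equiv.Perm (Fin n)) (D : Set (Fin n)) :
    FreeMonogenicInverseMonoid →* SymmetricInverseMonoid n where
  toFun := pathMap σ D
  map_one' := by
    refine ext_rel fun u v => ?_
    rw [rel_pathMap, rel_one]
    simp only [lo_one, hi_one, disp_one, zpow_zero, Equiv.Perm.one_apply]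
    exact ⟨fun h => h.2, fun h => ⟨fun l h1 h2 => by omega, h⟩⟩
  map_mul' s t := by
    refine ext_rel fun u v => ?_
    simp only [rel_pathMap, rel_mul, lo_mul, hi_mul, disp_mul]
    have hadd : ∀ l, (σ ^ l) ((σ ^ s.disp) u) = (σ ^ (s.disp + l)) u := fun l => by
      rw [← Equiv.Perm.mul_apply, ← zpow_add, add_comm]
    have := s.lo_le_disp
    have := s.disp_le_hi
    have := t.lo_nonpos
    have := t.hi_nonneg
    constructor
    · rintro ⟨h, rfl⟩
      refine ⟨_, ⟨fun l h1 h2 => h l (by omega) (by omega), rfl⟩, fun l h1 h2 => ?_, ?_⟩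
      · rw [hadd]
        exact h _ (by omega) (by omega)
      · rw [hadd, add_comm]
    · rintro ⟨_, ⟨h, rfl⟩, h', rfl⟩
      refine ⟨fun l h1 h2 => ?_, (hadd _).symm⟩
      rcases lt_or_ge l s.disp with hl | hl
      · rcases lt_or_ge l s.lo with hl' | hl'
        · have := h' (l - s.disp) (by omega) (by omega)
          rwa [hadd, add_sub_cancel] at this
        · exact h l hl' (by omega)
      · rcases lt_or_ge l s.hi with hl' | hl'
        · exact h l (by omega) hl'
        · have := h' (l - s.disp) (by omega) (by omega)
          rwa [hadd, add_sub_cancel] at this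

theorem rel_pathAction {σ : Equiv.Perm (Fin n)} {D : Set (Fin n)} {t : FreeMonogenicInverseMonoid}
    {u v : Fin n} : (pathAction σ D t).Rel u v ↔
      (∀ l, t.lo ≤ l → l < t.hi → (σ ^ l) u ∈ D) ∧ (σ ^ t.disp) u = v :=
  rel_pathMap

theorem pathAction_gen {f : SymmetricInverseMonoid n} {σ : Equiv.Perm (Fin n)} {D : Set (Fin n)}
    (h : ∀ u v, f.Rel u v ↔ u ∈ D ∧ σ u = v) : pathAction σ D gen = f := by
  refine ext_rel fun u v => ?_
  rw [rel_pathAction, h]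
  simp only [lo_gen, hi_gen, disp_gen, zpow_one]
  refine and_congr_left fun _ => ⟨fun h => h 0 le_rfl one_pos, fun h l h1 h2 => ?_⟩
  obtain rfl : l = 0 := by omega
  exact h

theorem pathAction_genInv {f : SymmetricInverseMonoid n} {σ : Equiv.Perm (Fin n)}
    {D : Set (Fin n)} (h : ∀ u v, f.Rel u v ↔ u ∈ D ∧ σ u = v) :
    pathAction σ D genInv = f⁻¹ := by
  refine ext_rel fun u v => ?_
  rw [rel_pathAction, rel_inv, h]
  simp only [lo_genInv, hi_genInv, disp_genInv]
  constructor
  · rintro ⟨h1, rfl⟩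
    exact ⟨h1 _ le_rfl (by omega), by simp⟩
  · rintro ⟨h1, rfl⟩
    refine ⟨fun l h2 h3 => ?_, by simp⟩
    obtain rfl : l = -1 := by omega
    simpa using h1

theorem mrange_pathAction {f : SymmetricInverseMonoid n} {σ : Equiv.Perm (Fin n)}
    {D : Set (Fin n)} (h : ∀ u v, f.Rel u v ↔ u ∈ D ∧ σ u = v) :
    MonoidHom.mrange (pathAction σ D) = Submonoid.closure {f, f⁻¹} := by
  rw [MonoidHom.mrange_eq_map, ← closure_gen, MonoidHom.map_mclosure, Set.image_pair,
    pathAction_gen h, pathAction_genInv h]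

theorem rel_pow {f : SymmetricInverseMonoid n} {σ : Equiv.Perm (Fin n)} {D : Set (Fin n)}
    (h : ∀ u v, f.Rel u v ↔ u ∈ D ∧ σ u = v) {k : ℕ} {u v : Fin n} :
    (f ^ k).Rel u v ↔ (∀ l : ℤ, 0 ≤ l → l < k → (σ ^ l) u ∈ D) ∧ (σ ^ k) u = v := by
  obtain ⟨h1, h2, h3⟩ := gen_pow k
  rw [← pathAction_gen h, ← map_pow, rel_pathAction, h1, h2, h3, zpow_natCast]

/-! ### The permuted core and the maximal chain. -/

/-- The points at which all powers of a partial bijection `f` are defined, when `f` has index `m`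
and period `r`: the partial bijection permutes them with order `r`. -/
theorem exists_core {f : SymmetricInverseMonoid n} {σ : Equiv.Perm (Fin n)} {D : Set (Fin n)}
    (h : ∀ u v, f.Rel u v ↔ u ∈ D ∧ σ u = v) {m r : ℕ} (hf : HasIndexPeriod f m r) :
    ∃ P : Finset (Fin n), (∀ (k : ℤ) (u : Fin n), (σ ^ k) u ∈ P ↔ u ∈ P) ∧
      (∀ (a b : ℤ) (u : Fin n), m ≤ b - a →
        ((∀ l, a ≤ l → l < b → (σ ^ l) u ∈ D) ↔ u ∈ P)) ∧
      r ∈ permOrders P.card ∧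
      ∀ k k' : ℤ, (∀ u ∈ P, (σ ^ k) u = (σ ^ k') u) ↔ k ≡ k' [ZMOD r] := by
  classical
  have hadd : ∀ (k l : ℤ) (u : Fin n), (σ ^ l) ((σ ^ k) u) = (σ ^ (k + l)) u := fun k l u => by
    rw [← Equiv.Perm.mul_apply, ← zpow_add, add_comm]
  let P : Finset (Fin n) := Finset.univ.filter fun u => ∀ l : ℤ, (σ ^ l) u ∈ D
  have hmem : ∀ u, u ∈ P ↔ ∀ l : ℤ, (σ ^ l) u ∈ D := fun u => by simp [P]
  have hinv : ∀ (k : ℤ) (u : Fin n), (σ ^ k) u ∈ P ↔ u ∈ P := by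
    intro k u
    rw [hmem, hmem]
    constructor
    · intro h l
      have := h (l - k)
      rwa [hadd, add_sub_cancel] at this
    · intro h l
      rw [hadd]
      exact h _
  -- Being defined for `m` steps means lying in the domain of `f ^ m`, which equals arbitrarily high
  -- powers of `f`. Negative exponents are covered because `σ` has finite order.
  have hdom : ∀ u, (∀ l : ℤ, 0 ≤ l → l < m → (σ ^ l) u ∈ D) → u ∈ P := by
    intro u hu
    rw [hmem]
    intro l
    have ho : (0 : ℤ) < orderOf σ := by exact_mod_cast orderOf_pos σ
    have hl : σ ^ l = σ ^ (l % orderOf σ) := (zpow_mod_orderOf σ l).symm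
    have hl0 := Int.emod_nonneg l ho.ne'
    rw [hl]
    have hpow : f ^ m = f ^ (m + r * ((l % orderOf σ).toNat + 1)) :=
      (hf.2 _ _).2 (Or.inr ⟨le_rfl, by omega, by simp [Nat.ModEq]⟩)
    have h1 : (f ^ m).Rel u ((σ ^ m) u) := (rel_pow h).2 ⟨hu, rfl⟩
    rw [hpow, rel_pow h] at h1
    refine h1.1 _ hl0 ?_
    have hle : (l % orderOf σ).toNat + 1 ≤ r * ((l % orderOf σ).toNat + 1) :=
      Nat.le_mul_of_pos_left _ hf.1
    omega
  have hwide : ∀ (a b : ℤ) (u : Fin n), m ≤ b - a →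
      ((∀ l, a ≤ l → l < b → (σ ^ l) u ∈ D) ↔ u ∈ P) := by
    intro a b u hab
    constructor
    · intro hu
      rw [← hinv a]
      refine hdom _ fun l h1 h2 => ?_
      rw [hadd]
      exact hu _ (by omega) (by omega)
    · exact fun hu l _ _ => (hmem u).1 hu l
  let π : Equiv.Perm P := σ.subtypePerm fun u => by simpa using hinv 1 u
  have hπ : ∀ k k' : ℤ, (∀ u ∈ P, (σ ^ k) u = (σ ^ k') u) ↔ π ^ k = π ^ k' := by
    intro k k'
    simp only [π, Equiv.Perm.subtypePerm_zpow]
    constructor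
    · intro hu
      ext ⟨u, hu'⟩
      simpa using congrArg Fin.val (hu u hu')
    · intro hk u hu
      have := congrArg Subtype.val (Equiv.ext_iff.1 hk ⟨u, hu⟩)
      simpa using this
  have hpowπ : ∀ i j : ℕ, m ≤ i → m ≤ j → (f ^ i = f ^ j ↔ π ^ i = π ^ j) := by
    intro i j hi hj
    rw [← zpow_natCast, ← zpow_natCast, ← hπ]
    have hrel : ∀ k : ℕ, m ≤ k → ∀ u v, (f ^ k).Rel u v ↔ u ∈ P ∧ (σ ^ (k : ℤ)) u = v := by
      intro k hk u v
      rw [rel_pow h, hwide 0 k u (by omega), zpow_natCast]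
    constructor
    · intro hij u hu
      have := (hrel i hi u _).2 ⟨hu, rfl⟩
      rw [hij, hrel j hj] at this
      exact this.2.symm
    · intro hij
      refine ext_rel fun u v => ?_
      rw [hrel i hi, hrel j hj]
      exact and_congr_right fun hu => by rw [hij u hu]
  have hord : orderOf π = r := by
    refine Nat.dvd_antisymm (orderOf_dvd_of_pow_eq_one ?_) ?_
    · have h1 := (hpowπ m (m + r) le_rfl (by omega)).1
        ((hf.2 _ _).2 (Or.inr ⟨le_rfl, by omega, by simp [Nat.ModEq]⟩))
      simpa [pow_add] using h1
    · have h1 := (hpowπ m (m + orderOf π) le_rfl (by omega)).2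
        (by rw [pow_add, pow_orderOf_eq_one, mul_one])
      rcases (hf.2 _ _).1 h1 with h2 | ⟨-, -, h2⟩
      · have := orderOf_pos π
        omega
      · simpa using (Nat.modEq_iff_dvd' (by omega)).1 h2
  refine ⟨P, hinv, hwide, ?_, fun k k' => ?_⟩
  · rw [← hord]
    exact orderOf_mem_permOrders (by simp) π
  · rw [hπ, zpow_eq_zpow_iff_modEq, hord]

/-- A chain of the maximal number `m` of points in a partial bijection of index `m`. -/
theorem exists_maximal_chain {f : SymmetricInverseMonoid n} {σ : Equiv.Perm (Fin n)}
    {D : Set (Fin n)} (h : ∀ u v, f.Rel u v ↔ u ∈ D ∧ σ u = v) {m r : ℕ}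
    (hf : HasIndexPeriod f m r) (hm : 0 < m) :
    ∃ u, (∀ l : ℤ, 0 ≤ l → l < m - 1 → (σ ^ l) u ∈ D) ∧
      (σ ^ (-1 : ℤ)) u ∉ D ∧ (σ ^ (m - 1 : ℤ)) u ∉ D := by
  obtain ⟨P, -, hwide, -, hmod⟩ := exists_core h hf
  obtain ⟨u, hu, huP⟩ : ∃ u, (∀ l : ℤ, 0 ≤ l → l < m - 1 → (σ ^ l) u ∈ D) ∧ u ∉ P := by
    by_contra! hcon
    -- If `m - 1` steps already forced a point into the core, these two powers would agree, against
    -- the index being `m`.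
    have hne : f ^ (m - 1) ≠ f ^ (m - 1 + r) := by
      rw [Ne, hf.2]
      rintro (h1 | h1)
      · have := hf.1
        omega
      · omega
    refine hne (ext_rel fun u v => ?_)
    have hr := hf.1
    rw [rel_pow h, rel_pow h, hwide 0 (m - 1 + r : ℕ) u (by omega), ← zpow_natCast, ← zpow_natCast]
    have h1 : (∀ l : ℤ, 0 ≤ l → l < (m - 1 : ℕ) → (σ ^ l) u ∈ D) ↔ u ∈ P := by
      constructor
      · exact fun h1 => hcon u fun l h2 h3 => h1 l h2 (by omega)
      · exact fun h1 l h2 h3 => (hwide 0 m u (by omega)).2 h1 l h2 (by omega)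
    rw [h1]
    refine and_congr_right fun hu => ?_
    rw [(hmod (m - 1 : ℕ) (m - 1 + r : ℕ)).2 (by simp [Int.ModEq]) u hu]
  -- Extending the chain at either end would allow `m` steps and so put `u` in the core.
  refine ⟨u, hu, fun h1 => huP ?_, fun h1 => huP ?_⟩
  · refine (hwide (-1) (m - 1) u (by omega)).1 fun l h2 h3 => ?_
    rcases eq_or_ne l (-1) with rfl | hl
    · exact h1
    · exact hu l (by omega) h3
  · refine (hwide 0 m u (by omega)).1 fun l h2 h3 => ?_
    rcases eq_or_ne l (m - 1) with rfl | hl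
    · exact h1
    · exact hu l h2 (by omega)

/-- A repetition would close the chain into a cycle, so that the predecessor of `u` would be a chain
point lying in `D`. -/
theorem chain_injective {σ : Equiv.Perm (Fin n)} {D : Set (Fin n)} {m : ℕ} {u : Fin n}
    (hu : ∀ l : ℤ, 0 ≤ l → l < m - 1 → (σ ^ l) u ∈ D) (hu' : (σ ^ (-1 : ℤ)) u ∉ D) {i j : ℤ}
    (hi : 0 ≤ i) (him : i < m) (hj : 0 ≤ j) (hjm : j < m) (hij : (σ ^ i) u = (σ ^ j) u) :
    i = j := by
  have key : ∀ i j : ℤ, 0 ≤ i → j < m → (σ ^ i) u = (σ ^ j) u → ¬ i < j := by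
    intro i j hi hj hij hlt
    apply hu'
    have h1 : (σ ^ (-1 : ℤ)) u = (σ ^ (j - i - 1)) u := by
      rw [show (-1 : ℤ) = (-i - 1) + i by ring, show j - i - 1 = (-i - 1) + j by ring, zpow_add,
        zpow_add, Equiv.Perm.mul_apply, Equiv.Perm.mul_apply, hij]
    rw [h1]
    exact hu _ (by omega) (by omega)
  exact le_antisymm (not_lt.1 (key j i hj him hij.symm)) (not_lt.1 (key i j hi hjm hij))

/-- The core and a maximal chain are disjoint, because the core is invariant under `σ` and all of it
lies in `D`, while the chain has a predecessor outside `D`. -/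
theorem index_le_and_period_mem {f : SymmetricInverseMonoid n} {m r : ℕ}
    (hf : HasIndexPeriod f m r) : m ≤ n ∧ r ∈ permOrders (n - m) := by
  classical
  obtain ⟨σ, D, h⟩ := f.exists_perm_rel
  obtain ⟨P, hinv, hwide, hr, -⟩ := exists_core h hf
  have hcard : P.card + m ≤ n := by
    rcases Nat.eq_zero_or_pos m with rfl | hm
    · simpa using Finset.card_le_univ P
    obtain ⟨u, hu, hu', hum⟩ := exists_maximal_chain h hf hm
    let C : Finset (Fin n) := (Finset.range m).image fun i : ℕ => (σ ^ (i : ℤ)) u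
    have hC : C.card = m := by
      rw [Finset.card_image_of_injOn, Finset.card_range]
      intro i hi j hj hij
      simp only [Finset.coe_range, Set.mem_Iio] at hi hj
      exact_mod_cast chain_injective hu hu' (by omega) (by omega) (by omega) (by omega) hij
    have hdisj : Disjoint P C := by
      rw [Finset.disjoint_right]
      intro x hx hxP
      obtain ⟨i, -, rfl⟩ := Finset.mem_image.1 hx
      rw [hinv, ← hwide (-1) m u (by omega)] at hxP
      exact hu' (hxP _ le_rfl (by omega))
    have := Finset.card_le_univ (P ∪ C)
    rwa [Finset.card_union_of_disjoint hdisj, hC, Fintype.card_fin] at this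
  exact ⟨by omega, permOrders_mono (by omega) hr⟩

/-! ### The kernel of the action and the resulting presentation. -/

/-- The kernel of the action of the free monogenic inverse monoid given by a partial bijection
depends only on the index and the period of this partial bijection. -/
theorem pathAction_eq_iff {f : SymmetricInverseMonoid n} {σ : Equiv.Perm (Fin n)}
    {D : Set (Fin n)} (h : ∀ u v, f.Rel u v ↔ u ∈ D ∧ σ u = v) {m r : ℕ}
    (hf : HasIndexPeriod f m r) (s t : FreeMonogenicInverseMonoid) :
    pathAction σ D s = pathAction σ D t ↔ IndexPeriodRel m r s t := by
  obtain ⟨P, -, hwide, -, hmod⟩ := exists_core h hf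
  have hsub : ∀ s t : FreeMonogenicInverseMonoid, pathAction σ D s = pathAction σ D t →
      ∀ u, (∀ l, s.lo ≤ l → l < s.hi → (σ ^ l) u ∈ D) →
        (∀ l, t.lo ≤ l → l < t.hi → (σ ^ l) u ∈ D) ∧ (σ ^ t.disp) u = (σ ^ s.disp) u := by
    intro s t hst u hu
    have := rel_pathAction.2 ⟨hu, rfl⟩
    rwa [hst, rel_pathAction] at this
  have hnarrow : ∀ s t : FreeMonogenicInverseMonoid, pathAction σ D s = pathAction σ D t →
      s.hi - s.lo < m → s.lo ≤ t.lo ∧ t.hi ≤ s.hi ∧ (t.disp ≤ s.hi → s.lo ≤ t.disp →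
        s.disp = t.disp) := by
    intro s t hst hs
    have := s.lo_nonpos
    have := s.hi_nonneg
    have := t.lo_nonpos
    have := t.hi_nonneg
    have := s.lo_le_disp
    have := s.disp_le_hi
    obtain ⟨u, hu, hu1, hum⟩ := exists_maximal_chain h hf (by omega)
    have hadd : ∀ k l : ℤ, (σ ^ l) ((σ ^ k) u) = (σ ^ (k + l)) u := fun k l => by
      rw [← Equiv.Perm.mul_apply, ← zpow_add, add_comm]
    -- The interval of `s`, of width less than `m`, is fitted against the left end of a maximal
    -- chain, and in `hright` against the right end. Since `t` has the same domain, it cannot reach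
    -- further on either side.
    have hleft := hsub s t hst ((σ ^ (-s.lo)) u) fun l h1 h2 => by
      rw [hadd]
      exact hu _ (by omega) (by omega)
    have hright := hsub s t hst ((σ ^ (m - 1 - s.hi)) u) fun l h1 h2 => by
      rw [hadd]
      exact hu _ (by omega) (by omega)
    simp only [hadd] at hleft hright
    refine ⟨?_, ?_, fun h1 h2 => ?_⟩
    · by_contra! hlt
      refine hu1 ?_
      have := hleft.1 (s.lo - 1) (by omega) (by omega)
      rwa [show -s.lo + (s.lo - 1) = -1 by ring] at this
    · by_contra! hlt
      refine hum ?_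
      have := hright.1 s.hi (by omega) (by omega)
      rwa [sub_add_cancel] at this
    · have := chain_injective hu hu1 (by omega) (by omega) (by omega) (by omega) hleft.2
      omega
  constructor
  · intro hst
    have heq : ∀ s t : FreeMonogenicInverseMonoid, pathAction σ D s = pathAction σ D t →
        s.hi - s.lo < m → s = t := by
      intro s t hst hs
      obtain ⟨h1, h2, h3⟩ := hnarrow s t hst hs
      obtain ⟨h4, h5, -⟩ := hnarrow t s hst.symm (by omega)
      have := t.lo_le_disp
      have := t.disp_le_hi
      ext
      · omega
      · omega
      · exact h3 (by omega) (by omega)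
    rcases lt_or_ge (s.hi - s.lo) m with hs | hs
    · exact Or.inl (heq s t hst hs)
    rcases lt_or_ge (t.hi - t.lo) m with ht | ht
    · exact Or.inl (heq t s hst.symm ht).symm
    refine Or.inr ⟨hs, ht, (hmod _ _).1 fun u hu => ?_⟩
    exact (hsub s t hst u ((hwide _ _ u hs).2 hu)).2.symm
  · rintro (rfl | ⟨hs, ht, hst⟩)
    · rfl
    · refine ext_rel fun u v => ?_
      rw [rel_pathAction, rel_pathAction, hwide _ _ u hs, hwide _ _ u ht]
      exact and_congr_right fun hu => by rw [(hmod _ _).2 hst u hu]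

/-- A presentation of a monogenic inverse submonoid by its index and period. -/
theorem exists_surjective_of_closure {f : SymmetricInverseMonoid n}
    {N : Submonoid (SymmetricInverseMonoid n)} (hN : N = Submonoid.closure {f, f⁻¹}) {m r : ℕ}
    (hf : HasIndexPeriod f m r) :
    ∃ φ : FreeMonogenicInverseMonoid →* N, Function.Surjective φ ∧
      ∀ s t, φ s = φ t ↔ IndexPeriodRel m r s t := by
  obtain ⟨σ, D, h⟩ := f.exists_perm_rel
  obtain rfl : N = MonoidHom.mrange (pathAction σ D) := hN.trans (mrange_pathAction h).symm
  refine ⟨(pathAction σ D).mrangeRestrict, MonoidHom.mrangeRestrict_surjective _,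
    fun s t => ?_⟩
  rw [← pathAction_eq_iff h hf, ← Subtype.coe_inj, MonoidHom.coe_mrangeRestrict,
    MonoidHom.coe_mrangeRestrict]

/-- The laws must hold at all elements, not only at powers of `f`; this is where
`indexPeriodRel_pow` enters. -/
theorem isOfIndexPeriod_of_closure {f : SymmetricInverseMonoid n}
    {N : Submonoid (SymmetricInverseMonoid n)} (hN : N = Submonoid.closure {f, f⁻¹}) {m r : ℕ}
    (hf : HasIndexPeriod f m r) : Monoid.IsOfIndexPeriod N m r := by
  obtain ⟨φ, hφ, hker⟩ := exists_surjective_of_closure hN hf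
  refine ⟨hf.1, fun i j => ?_⟩
  constructor
  · intro H
    rw [← indexPeriodRel_gen_pow, ← hker, map_pow, map_pow, H]
  · intro H x
    obtain ⟨t, rfl⟩ := hφ x
    rw [← map_pow, ← map_pow, hker]
    exact indexPeriodRel_pow H t

/-- Inversion reverses products and swaps the two generators, so it preserves the closure. -/
theorem isMonogenicInverseSubmonoid_closure (f : SymmetricInverseMonoid n) :
    IsMonogenicInverseSubmonoid (Submonoid.closure {f, f⁻¹}) := by
  refine ⟨fun x hx => ?_, f, Submonoid.subset_closure (by simp), rfl⟩
  have hinv : ∀ g : SymmetricInverseMonoid n, g⁻¹⁻¹ = g := fun g =>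
    ext_rel fun u v => by rw [rel_inv, rel_inv]
  have hmul : ∀ g g' : SymmetricInverseMonoid n, (g * g')⁻¹ = g'⁻¹ * g⁻¹ := fun g g' =>
    ext_rel fun u v => by
      simp only [rel_inv, rel_mul]
      exact exists_congr fun w => and_comm
  have hone : (1 : SymmetricInverseMonoid n)⁻¹ = 1 :=
    ext_rel fun u v => by rw [rel_inv, rel_one, rel_one, eq_comm]
  induction hx using Submonoid.closure_induction with
  | mem x hx =>
    refine Submonoid.subset_closure ?_
    rcases hx with rfl | rfl
    · simp
    · simp [hinv]
  | one => rw [hone]; exact one_mem _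
  | mul x y _ _ hx hy => rw [hmul]; exact mul_mem hy hx

/-! ### Realising every index and period. -/

/-- The graph of the `k`-th power of the partial bijection that permutes
`c` points by `g` and moves `m` points along a chain. -/
inductive PermChainRel {c : ℕ} (m : ℕ) (g : Equiv.Perm (Fin c)) (k : ℕ) :
    Fin c ⊕ Fin m → Fin c ⊕ Fin m → Prop
  | perm (x y : Fin c) (h : (g ^ k) x = y) : PermChainRel m g k (Sum.inl x) (Sum.inl y)
  | chain (y z : Fin m) (h : (z : ℕ) = y + k) : PermChainRel m g k (Sum.inr y) (Sum.inr z)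

theorem permChainRel_succ {c m : ℕ} {g : Equiv.Perm (Fin c)} {k : ℕ} {u v : Fin c ⊕ Fin m} :
    PermChainRel m g (k + 1) u v ↔ ∃ w, PermChainRel m g k u w ∧ PermChainRel m g 1 w v := by
  constructor
  · rintro (⟨x, y, h⟩ | ⟨y, z, h⟩)
    · refine ⟨_, .perm x _ rfl, .perm _ _ ?_⟩
      rw [← h, ← Equiv.Perm.mul_apply, ← pow_add, add_comm]
    · exact ⟨Sum.inr ⟨y + k, by omega⟩, .chain _ _ rfl, .chain _ _ (by simp only; omega)⟩
  · rintro ⟨w, ⟨x, y, h⟩ | ⟨y, z, h⟩, h'⟩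
    · cases h' with
      | perm _ y' h' =>
        refine .perm x y' ?_
        rw [← h', ← h, ← Equiv.Perm.mul_apply, ← pow_add, add_comm]
    · cases h' with
      | chain _ z' h' => exact .chain _ _ (by omega)

theorem PermChainRel.right_unique {c m : ℕ} {g : Equiv.Perm (Fin c)} {k : ℕ}
    {u v w : Fin c ⊕ Fin m} (h : PermChainRel m g k u v) (h' : PermChainRel m g k u w) :
    v = w := by
  cases h with
  | perm x y h => cases h' with | perm _ z h' => rw [← h, ← h']
  | chain x y h => cases h' with | chain _ z h' => exact congrArg Sum.inr (Fin.ext (by omega))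

theorem PermChainRel.left_unique {c m : ℕ} {g : Equiv.Perm (Fin c)} {k : ℕ}
    {u v w : Fin c ⊕ Fin m} (h : PermChainRel m g k u w) (h' : PermChainRel m g k v w) :
    u = v := by
  cases h with
  | perm x y h =>
    cases h' with | perm z _ h' => exact congrArg Sum.inl ((g ^ k).injective (h.trans h'.symm))
  | chain x y h => cases h' with | chain z _ h' => exact congrArg Sum.inr (Fin.ext (by omega))

theorem exists_hasIndexPeriod_of_perm {c m : ℕ} (hcm : c + m = n) (g : Equiv.Perm (Fin c)) :
    ∃ f : SymmetricInverseMonoid n, HasIndexPeriod f m (orderOf g) := by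
  subst hcm
  let e : Fin (c + m) ≃ Fin c ⊕ Fin m := finSumFinEquiv.symm
  let f : SymmetricInverseMonoid (c + m) := ofRel (fun u v => PermChainRel m g 1 (e u) (e v))
    (fun _ _ _ h h' => e.injective (h.right_unique h'))
    (fun _ _ _ h h' => e.injective (h.left_unique h'))
  have hpow : ∀ k u v, (f ^ k).Rel u v ↔ PermChainRel m g k (e u) (e v) := by
    intro k
    induction k with
    | zero =>
      intro u v
      rw [pow_zero, rel_one, ← e.apply_eq_iff_eq]
      constructor
      · intro h
        rw [← h]
        rcases e u with x | y
        · exact .perm x x rfl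
        · exact .chain y y rfl
      · intro h
        generalize e u = a at h
        generalize e v = b at h
        cases h with
        | perm x y h => exact congrArg Sum.inl h
        | chain y z h => exact congrArg Sum.inr (Fin.ext (by omega))
    | succ k ih =>
      intro u v
      rw [pow_succ, rel_mul, permChainRel_succ]
      rw [← e.exists_congr_right (q := fun w =>
        PermChainRel m g k (e u) w ∧ PermChainRel m g 1 w (e v))]
      exact exists_congr fun w => and_congr (ih u w) rel_ofRel
  have heq : ∀ i j, f ^ i = f ^ j ↔ ∀ a b, PermChainRel m g i a b ↔ PermChainRel m g j a b := by
    intro i j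
    constructor
    · intro h a b
      have := hpow i (e.symm a) (e.symm b)
      rw [h, hpow] at this
      simpa using this.symm
    · intro h
      exact ext_rel fun u v => by rw [hpow, hpow, h]
  refine ⟨f, hasIndexPeriod_of_lt (orderOf_pos g) fun i j hij => ?_⟩
  rw [heq]
  constructor
  · intro h
    constructor
    · by_contra! hi
      -- For `i < m` the `i`-th power moves the start of the chain to position `i`, which the `j`-th
      -- power does not.
      have := (h (Sum.inr ⟨0, by omega⟩) (Sum.inr ⟨i, hi⟩)).1 (.chain _ _ (by simp))
      cases this with
      | chain _ _ h => simp only at h; omega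
    · rw [← pow_eq_pow_iff_modEq]
      ext x
      have := (h (Sum.inl x) _).1 (.perm x _ rfl)
      cases this with
      | perm _ _ h => rw [h]
  · rintro ⟨hi, h⟩ a b
    rw [← pow_eq_pow_iff_modEq] at h
    constructor
    · rintro (⟨x, y, h'⟩ | ⟨y, z, h'⟩)
      · exact .perm x y (h ▸ h')
      · omega
    · rintro (⟨x, y, h'⟩ | ⟨y, z, h'⟩)
      · exact .perm x y (h ▸ h')
      · omega

end SymmetricInverseMonoid

/-! ### The two counts. -/

theorem numMonogenicInverseSubmonoids_eq_sum (n : ℕ) :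
    numMonogenicInverseSubmonoids n =
      ∑ m ∈ Finset.range (n + 1), numCyclicSubgroups (n - m) := by
  rw [← ncard_indexPeriod, numMonogenicInverseSubmonoids]
  refine numIsoClasses_eq_ncard _ _ ?_ ?_ ?_
  · rintro ⟨N, -, f, -, hN⟩
    obtain ⟨m, r, hf⟩ := exists_hasIndexPeriod f
    have := SymmetricInverseMonoid.index_le_and_period_mem hf
    exact ⟨(m, r), ⟨Nat.lt_succ_of_le this.1, this.2⟩,
      SymmetricInverseMonoid.isOfIndexPeriod_of_closure hN hf⟩
  · rintro ⟨m, r⟩ ⟨h1, g, hg⟩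
    simp only at h1 hg g
    obtain ⟨f, hf⟩ := SymmetricInverseMonoid.exists_hasIndexPeriod_of_perm
      (n := n) (m := m) (by omega) g
    rw [hg] at hf
    exact ⟨⟨_, SymmetricInverseMonoid.isMonogenicInverseSubmonoid_closure f⟩,
      SymmetricInverseMonoid.isOfIndexPeriod_of_closure rfl hf⟩
  · rintro ⟨M, _, f, _, hM⟩ ⟨N, _, g, _, hN⟩ m r h h'
    -- The generator is an arbitrary choice; its index and period are recovered from the laws of the
    -- submonoid.
    have key : ∀ (K : Submonoid (SymmetricInverseMonoid n)) (x : SymmetricInverseMonoid n),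
        K = Submonoid.closure {x, x⁻¹} → Monoid.IsOfIndexPeriod K m r →
        HasIndexPeriod x m r := by
      intro K x hK hmr
      obtain ⟨m', r', hx⟩ := exists_hasIndexPeriod x
      obtain ⟨rfl, rfl⟩ := hmr.unique (SymmetricInverseMonoid.isOfIndexPeriod_of_closure hK hx)
      exact hx
    obtain ⟨φ, hφ, hφk⟩ :=
      SymmetricInverseMonoid.exists_surjective_of_closure hM (key M f hM h)
    obtain ⟨ψ, hψ, hψk⟩ :=
      SymmetricInverseMonoid.exists_surjective_of_closure hN (key N g hN h')
    exact nonempty_mulEquiv_of_ker_eq φ ψ hφ hψ fun a b => (hφk a b).trans (hψk a b).symm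

theorem numCyclicSubgroups_zero : numCyclicSubgroups 0 = 1 := by
  rw [numCyclicSubgroups_eq_ncard, Set.ncard_eq_one]
  refine ⟨1, ?_⟩
  rw [Set.range_unique, Subsingleton.elim default (1 : Equiv.Perm (Fin 0)), orderOf_one]

theorem theorem1 (n : ℕ) (hn : 1 < n) :
    numMonogenicSubmonoids n = ∑ k ∈ Finset.Icc 1 n, numCyclicSubgroups k ∧
    numMonogenicInverseSubmonoids n = ∑ k ∈ Finset.Icc 0 n, numCyclicSubgroups k ∧
    numMonogenicInverseSubmonoids n = numMonogenicSubmonoids n + 1 := by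
  have h1 := numMonogenicSubmonoids_eq_sum (n := n) (by omega)
  have h2 := numMonogenicInverseSubmonoids_eq_sum n
  have h3 : numMonogenicInverseSubmonoids n = numMonogenicSubmonoids n + 1 := by
    rw [h1, h2, Finset.sum_range_succ, Nat.sub_self, numCyclicSubgroups_zero]
  have h4 : numMonogenicInverseSubmonoids n = ∑ k ∈ Finset.Icc 0 n, numCyclicSubgroups k := by
    rw [h2, ← Finset.sum_range_reflect, ← Nat.range_succ_eq_Icc_zero]
    refine Finset.sum_congr rfl fun k hk => ?_
    rw [Finset.mem_range] at hk
    congr 1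
    omega
  refine ⟨?_, h4, h3⟩
  -- Splitting off the term `k = 0`, which is `1`, and cancelling it gives the sum from `1`.
  rw [← Finset.insert_Icc_succ_left_eq_Icc (Nat.zero_le n), Finset.sum_insert (by simp),
    numCyclicSubgroups_zero, h3, add_comm] at h4
  simpa using h4
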